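/- Consider a slotted network ($t=0,1,2,\dots$) with $N$ adaptive users and $M$ channels, where each channel $j$ is assigned its own uncooperative user, also denoted $j$. Adaptive user $i$ may transmit only on the channels in $J(i)\subseteq\{1,\dots,M\}$. In slot $t$, $A^j_u(t)\in\{0,1\}$ packets arrive to uncooperative user $j$, Bernoulli with rate $\lambda^j_u$, and $A^i_a(t)\le A_{\max}$ packets arrive to adaptive user $i$, i.i.d. over $t$ with mean $\lambda^i_a$; all arrivals are independent. Let $Q^j_u(t)$ and $Q^i_a(t)$ be the backlogs after the arrivals of slot $t$; all queues are empty before slot $0$. An uncooperative user transmits one packet on its channel in every slot in which its queue is nonempty. At most one adaptive user transmits on a channel in a slot. A transmission succeeds, and the packet (unless it is a dummy packet) leaves its queue, if and only if nobody else transmits on that channel in that slot; otherwise there is a collision and the packets stay queued. For $\lambda\in[0,1]$ put $$\mu_{lb}(\lambda)=\begin{cases}1-2\lambda,&\lambda\le\frac13\\ \frac{(1-\lambda)^2}{4\lambda},&\lambda>\frac13\end{cases}\qquad p^*(\lambda)=\begin{cases}1,&\lambda\le\frac13\\ \frac{1-\lambda}{2\lambda},&\lambda>\frac13\end{cases}$$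 and $\mu^j_{lb}=\mu_{lb}(\lambda^j_u)$. The Longest Queue First policy works as follows. On every channel $j$ no attempt is made in a slot directly following a collision on $j$; in every other slot an attempt is made with probability $p^*(\lambda^j_u)$, with coins that are independent over slots and channels and independent of all arrivals. Each attempt on $j$ in slot $t$ is given to an adaptive user maximizing $Q^i_a(t)$ among the users $i$ with $j\in J(i)$, ties being broken arbitrarily (if there is no such user, nobody makes the attempt). An adaptive user sends a different packet of its queue on each channel given to it, and dummy packets on the remaining ones if it is given more channels than it has queued packets. Theorem. Suppose that there are $\rho_{(i,j)}\in[0,1]$, for $1\le i\le N$ and $j\in J(i)$, with $$\sum_{j\in J(i)}\rho_{(i,j)}\ge\lambda^i_a\quad(1\le i\le N),\qquad \sum_{i:\,j\in J(i)}\rho_{(i,j)}\le\mu^j_{lb}\quad(1\le j\le M).$$ Then under the Longest Queue First policy every queue is rate stable: with probability one, $\lim_{T\to\infty}Q^i_a(T)/T=0$ for every adaptive user $i$ and $\lim_{T\to\infty}Q^j_u(T)/T=0$ for every uncooperative user $j$. -/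

import Mathlib

open MeasureTheory ProbabilityTheory Filter Topology

namespace LQF

/-- Largest throughput of the back-off policy on a channel whose uncooperative user has
arrival rate `lam`. -/
noncomputable def muLb (lam : ℝ) : ℝ :=
  if lam ≤ 1 / 3 then 1 - 2 * lam else (1 - lam) ^ 2 / (4 * lam)

/-- The transmission probability with which the back-off policy attains `muLb lam`. -/
noncomputable def pStar (lam : ℝ) : ℝ :=
  if lam ≤ 1 / 3 then 1 else (1 - lam) / (2 * lam)

/-- Ternary feedback of a channel at the end of a slot. -/
inductive Feedback where
  | success
  | collision
  | idle
  deriving DecidableEq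

/-- Feedback of a collision channel, from the backlog `q` of its uncooperative user (who transmits
exactly when `q > 0`) and the adaptive user that transmits on it, if any. -/
def feedback {N : ℕ} (q : ℕ) (tx : Option (Fin N)) : Feedback :=
  if q = 0 then (if tx = none then .idle else .success)
  else (if tx = none then .success else .collision)

/-- State in slot `t`: the backlogs after the arrivals of slot `t`, and the feedback received at
the end of slot `t - 1`. -/
structure State (N M : ℕ) where
  qa : Fin N → ℕ
  qu : Fin M → ℕ
  fb : Fin M → Feedback

/-- The back-off policy of a channel: no attempt right after a collision, otherwise an attempt
exactly when the coin of this slot shows `1`. -/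
def lbAttempt (last : Feedback) (coin : ℕ) : Prop := last ≠ .collision ∧ coin = 1

instance (last : Feedback) (coin : ℕ) : Decidable (lbAttempt last coin) :=
  inferInstanceAs (Decidable (_ ∧ _))

/-- A rule that names, for a backlog vector `q` and a channel `j`, the adaptive user to which an
attempt on `j` is given. -/
abbrev SelectRule (Ω : Type*) (N M : ℕ) := ℕ → Ω → (Fin N → ℕ) → Fin M → Option (Fin N)

/-- Longest Queue First: the chosen user is allowed on the channel and has the largest backlog
among the users allowed on it; nobody is chosen only if nobody is allowed. Ties may be broken in any
way, depending on the slot and on the outcome (hence on the whole history). -/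
def IsLongestQueueFirst {Ω : Type*} {N M : ℕ} (J : Fin N → Finset (Fin M))
    (sel : SelectRule Ω N M) : Prop :=
  ∀ t ω q j,
    (∀ i, sel t ω q j = some i → j ∈ J i ∧ ∀ i', j ∈ J i' → q i' ≤ q i) ∧
    (sel t ω q j = none → ∀ i, j ∉ J i)

/-- A rule that says on which of the channels `S` assigned to it an adaptive user `i` with
backlog `q` sends packets of its queue. Dummy packets are sent on the other channels of `S`. -/
abbrev DataRule (Ω : Type*) (N M : ℕ) :=
  ℕ → Ω → Fin N → (q : ℕ) → (S : Finset (Fin M)) → Finset (Fin M)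

/-- A distinct packet of the queue is sent on every assigned channel, with dummy packets only for
want of queued packets. -/
def IsDataRule {Ω : Type*} {N M : ℕ} (dat : DataRule Ω N M) : Prop :=
  ∀ t ω i q S, dat t ω i q S ⊆ S ∧ (dat t ω i q S).card = min S.card q

/-- The adaptive user that transmits on channel `j` in state `s`, where `sel` and `coin` are those
of the current slot and outcome. -/
def transmitter {N M : ℕ} (sel : (Fin N → ℕ) → Fin M → Option (Fin N)) (coin : Fin M → ℕ)
    (s : State N M) (j : Fin M) : Option (Fin N) :=
  if lbAttempt (s.fb j) (coin j) then sel s.qa j else none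

/-- The channels on which adaptive user `i` transmits. -/
def assigned {N M : ℕ} (tx : Fin M → Option (Fin N)) (i : Fin N) : Finset (Fin M) :=
  Finset.univ.filter fun j => tx j = some i

/-- Number of packets that leave the queue of adaptive user `i`: a packet sent on channel `j`
departs exactly when the uncooperative user of `j` does not transmit. -/
def departA {N M : ℕ} (dat : Fin N → ℕ → Finset (Fin M) → Finset (Fin M))
    (tx : Fin M → Option (Fin N)) (s : State N M) (i : Fin N) : ℕ :=
  ((dat i (s.qa i) (assigned tx i)).filter fun j => s.qu j = 0).card

/-- Number of packets that leave the queue of the uncooperative user of channel `j`. -/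
def departU {N M : ℕ} (tx : Fin M → Option (Fin N)) (s : State N M) (j : Fin M) : ℕ :=
  if 0 < s.qu j ∧ tx j = none then 1 else 0

/-- The state of the network in every slot. Before slot `0` all queues are empty and the channels
are idle. `Aa`, `Au` are the arrivals of the adaptive and uncooperative users, `coin` the coins of
the back-off policies. -/
def path {Ω : Type*} {N M : ℕ} (sel : SelectRule Ω N M) (dat : DataRule Ω N M)
    (Aa : Fin N → ℕ → Ω → ℕ) (Au coin : Fin M → ℕ → Ω → ℕ) (ω : Ω) : ℕ → State N M
  | 0 => { qa := fun i => Aa i 0 ω, qu := fun j => Au j 0 ω, fb := fun _ => .idle }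
  | t + 1 =>
    let s := path sel dat Aa Au coin ω t
    let tx := transmitter (sel t ω) (fun j => coin j t ω) s
    { qa := fun i => s.qa i - departA (dat t ω) tx s i + Aa i (t + 1) ω
      qu := fun j => s.qu j - departU tx s j + Au j (t + 1) ω
      fb := fun j => feedback (s.qu j) (tx j) }

/-- `X` takes the values `0` and `1`, the latter with probability `p`. -/
def IsBernoulli {Ω : Type*} [MeasurableSpace Ω] (P : Measure Ω) (X : Ω → ℕ) (p : ℝ) : Prop :=
  Measurable X ∧ (∀ ω, X ω = 0 ∨ X ω = 1) ∧ P.real {ω | X ω = 1} = p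

/-- The probabilistic model: i.i.d. bounded arrivals of mean `lamA i` to the adaptive users,
Bernoulli arrivals of rate `lamU j` to the uncooperative users, coins of bias `pStar (lamU j)` for
the back-off policies, everything independent. -/
structure IsNetworkModel {Ω : Type*} [MeasurableSpace Ω] (P : Measure Ω) {N M : ℕ}
    (lamA : Fin N → ℝ) (lamU : Fin M → ℝ)
    (Aa : Fin N → ℕ → Ω → ℕ) (Au coin : Fin M → ℕ → Ω → ℕ) : Prop where
  measurable_Aa : ∀ i t, Measurable (Aa i t)
  bounded_Aa : ∃ Amax : ℕ, ∀ i t ω, Aa i t ω ≤ Amax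
  identDistrib_Aa : ∀ i t, IdentDistrib (Aa i t) (Aa i 0) P P
  mean_Aa : ∀ i, ∫ ω, (Aa i 0 ω : ℝ) ∂P = lamA i
  bernoulli_Au : ∀ j t, IsBernoulli P (Au j t) (lamU j)
  bernoulli_coin : ∀ j t, IsBernoulli P (coin j t) (pStar (lamU j))
  indep : iIndepFun
    (fun k : (Fin N ⊕ Fin M ⊕ Fin M) × ℕ => Sum.elim Aa (Sum.elim Au coin) k.1 k.2) P

/-- A queue length process is rate stable: `Q T / T → 0` with probability one. -/
def RateStable {Ω : Type*} [MeasurableSpace Ω] (P : Measure Ω) (Q : ℕ → Ω → ℕ) : Prop :=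
  ∀ᵐ ω ∂P, Tendsto (fun T : ℕ => (Q T ω : ℝ) / (T : ℝ)) atTop (𝓝 0)

end LQF

namespace LQF

open Asymptotics Finset

/-! Longest Queue First leaves no attempt unused on a channel that some adaptive user may use, so
the uncooperative backlog and the collision flag there evolve independently of how attempts are
shared out. This autonomous process is `channel`, identified with the network in `path_eq_channel`.
With attempt probability `p`, an uncooperative packet occupies its channel for `1 + p` slots on
average. The function `workload` turns this into an exact balance (`workload_succ_sub`): work
arrives at rate `(1 + p) * lam`, one unit is cleared per slot unless the queue is empty, and the
rest is martingale noise. Reflection at zero makes the workload sublinear, so the queue is empty in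
a fraction `1 - (1 + p) * lam` of the slots, and attempts succeed at rate `p * (1 - (1 + p) * lam)`,
which is `muLb lam` for `p = pStar lam`. The adaptive queues are treated pathwise with the sum of
squared backlogs. By feasibility of the rates and the choice of the longest queue, its increment is
bounded by a constant plus centered arrivals and centered successes weighted by backlogs
(`sum_sq_backlog_succ_le`). The weights are Lipschitz in time, so summation by parts
(`sum_range_mul_sub_isLittleO`) shows that the noise adds up to `o(T ^ 2)`. No independence of
backlogs and successes is needed, hence tie-breaking may be arbitrary. -/

/-! ### Deterministic estimates for sublinear sequences. -/

theorem tendsto_div_natCast_iff_isLittleO {x : ℕ → ℝ} :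
    Tendsto (fun T : ℕ => x T / (T : ℝ)) atTop (𝓝 0) ↔ x =o[atTop] fun T : ℕ => (T : ℝ) := by
  refine (isLittleO_iff_tendsto' ?_).symm
  filter_upwards [eventually_gt_atTop 0] with T hT h0
  exact absurd h0 (by positivity)

/-- A sublinear sequence lies below an affine function of arbitrarily small slope. -/
theorem exists_abs_le_add_mul_of_isLittleO {z : ℕ → ℝ} (hz : z =o[atTop] fun T : ℕ => (T : ℝ))
    {ε : ℝ} (hε : 0 < ε) : ∃ C : ℝ, ∀ T : ℕ, |z T| ≤ C + ε * T := by
  obtain ⟨n, hn⟩ := eventually_atTop.1 (hz.def hε)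
  refine ⟨∑ t ∈ range n, |z t|, fun T => ?_⟩
  have hs : 0 ≤ ∑ t ∈ range n, |z t| := sum_nonneg fun _ _ => abs_nonneg _
  rcases lt_or_ge T n with h | h
  · have := single_le_sum (f := fun t => |z t|) (fun _ _ => abs_nonneg _) (mem_range.2 h)
    have : 0 ≤ ε * T := by positivity
    linarith
  · have := hn T h
    simp only [Real.norm_eq_abs, Nat.abs_cast] at this
    linarith

theorem isLittleO_of_forall_abs_le_add_mul {x : ℕ → ℝ}
    (h : ∀ ε > 0, ∃ C : ℝ, ∀ T : ℕ, |x T| ≤ C + ε * T) : x =o[atTop] fun T : ℕ => (T : ℝ) := by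
  refine IsLittleO.of_bound fun ε hε => ?_
  obtain ⟨C, hC⟩ := h (ε / 2) (half_pos hε)
  filter_upwards [(tendsto_natCast_atTop_atTop (R := ℝ)).eventually_ge_atTop (C / (ε / 2))]
    with T hT
  rw [div_le_iff₀ (half_pos hε)] at hT
  have := hC T
  simp only [Real.norm_eq_abs, Nat.abs_cast]
  linarith

/-- A nonnegative process that is reflected at zero and otherwise grows no faster than a sublinear
process is sublinear. -/
theorem isLittleO_of_reflected {x z : ℕ → ℝ} {K : ℝ} (hx : ∀ t, 0 ≤ x t) (h0 : x 0 ≤ K)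
    (hzero : ∀ t, x t = 0 → x (t + 1) ≤ K)
    (hpos : ∀ t, 0 < x t → x (t + 1) - x t ≤ z (t + 1) - z t)
    (hz : z =o[atTop] fun T : ℕ => (T : ℝ)) : x =o[atTop] fun T : ℕ => (T : ℝ) := by
  -- The witness `s` is the slot after the last zero of `x` before `T`, or `0` if there is none:
  -- there `x s ≤ K`, and from then on the increments of `z` dominate.
  have key : ∀ T, ∃ s ≤ T, x T ≤ K + z T - z s := by
    intro T
    induction T with
    | zero => exact ⟨0, le_rfl, by linarith⟩
    | succ T ih =>
      rcases (hx T).eq_or_lt with h | h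
      · exact ⟨T + 1, le_rfl, by linarith [hzero T h.symm]⟩
      · obtain ⟨s, hs, hs'⟩ := ih
        exact ⟨s, by omega, by linarith [hpos T h]⟩
  refine isLittleO_of_forall_abs_le_add_mul fun ε hε => ?_
  obtain ⟨C, hC⟩ := exists_abs_le_add_mul_of_isLittleO hz (half_pos hε)
  refine ⟨K + 2 * C, fun T => ?_⟩
  obtain ⟨s, hs, hsT⟩ := key T
  rw [abs_of_nonneg (hx T)]
  have h1 := abs_le.1 (hC T)
  have h2 := abs_le.1 (hC s)
  have h3 : ε / 2 * (s : ℝ) ≤ ε / 2 * T := by gcongr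
  linarith [h1.2, h2.1]

theorem sum_range_mul_sub_eq (m z : ℕ → ℝ) (T : ℕ) :
    ∑ t ∈ range T, m t * (z (t + 1) - z t) =
      m T * z T - m 0 * z 0 - ∑ t ∈ range T, (m (t + 1) - m t) * z (t + 1) := by
  induction T with
  | zero => simp
  | succ T ih => rw [sum_range_succ, sum_range_succ, ih]; ring

theorem natCast_isLittleO_sq : (fun T : ℕ => (T : ℝ)) =o[atTop] fun T : ℕ => (T : ℝ) ^ 2 := by
  have := (isLittleO_pow_pow_atTop_of_lt (𝕜 := ℝ) one_lt_two).comp_tendsto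
    (tendsto_natCast_atTop_atTop (R := ℝ))
  simpa [Function.comp_def] using this

theorem const_isLittleO_natCast (c : ℝ) : (fun _ : ℕ => c) =o[atTop] fun T : ℕ => (T : ℝ) :=
  isLittleO_const_left.2 <| .inr <| by
    simpa [Function.comp_def] using tendsto_natCast_atTop_atTop (R := ℝ)

/-- Summation by parts: the increments of a sublinear process, weighted with a Lipschitz process,
have a subquadratic sum. -/
theorem sum_range_mul_sub_isLittleO {m z : ℕ → ℝ} {L : ℝ} (hm : ∀ t, |m (t + 1) - m t| ≤ L)
    (hz : z =o[atTop] fun T : ℕ => (T : ℝ)) :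
    (fun T => ∑ t ∈ range T, m t * (z (t + 1) - z t)) =o[atTop] fun T : ℕ => (T : ℝ) ^ 2 := by
  have hgrow : ∀ T : ℕ, |m T| ≤ |m 0| + L * T := by
    intro T
    induction T with
    | zero => simp
    | succ T ih =>
      have := abs_add_le (m (T + 1) - m T) (m T)
      rw [sub_add_cancel] at this
      push_cast
      linarith [hm T]
  have hmO : m =O[atTop] fun T : ℕ => (T : ℝ) := by
    have h1 : (fun T : ℕ => |m 0| + L * T) =O[atTop] fun T : ℕ => (T : ℝ) :=
      (const_isLittleO_natCast _).isBigO.add ((isBigO_refl _ _).const_mul_left L)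
    refine IsBigO.trans (IsBigO.of_bound 1 (.of_forall fun T => ?_)) h1
    rw [one_mul, Real.norm_eq_abs, Real.norm_eq_abs]
    exact (hgrow T).trans (le_abs_self _)
  have hsucc : (fun t : ℕ => z (t + 1)) =o[atTop] fun t : ℕ => (t : ℝ) + 1 := by
    have := hz.comp_tendsto (tendsto_add_atTop_nat 1)
    simpa [Function.comp_def] using this
  have hdm : (fun t => m (t + 1) - m t) =O[atTop] fun _ : ℕ => (1 : ℝ) :=
    IsBigO.of_bound L (.of_forall fun t => by simpa using hm t)
  have hsummand : (fun t => (m (t + 1) - m t) * z (t + 1)) =o[atTop] fun t : ℕ => (t : ℝ) + 1 := by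
    simpa using hdm.mul_isLittleO hsucc
  -- The lower bound makes the comparison series diverge, as summing a little-o requires; the upper
  -- bound `hle` turns the result into `o(T ^ 2)`.
  have hge : ∀ T : ℕ, (T : ℝ) ≤ ∑ t ∈ range T, ((t : ℝ) + 1) := fun T => by
    calc (T : ℝ) = ∑ t ∈ range T, (1 : ℝ) := by simp
      _ ≤ _ := sum_le_sum fun t _ => by linarith [t.cast_nonneg (α := ℝ)]
  have hle : ∀ T : ℕ, ∑ t ∈ range T, ((t : ℝ) + 1) ≤ (T : ℝ) ^ 2 := fun T => by
    calc ∑ t ∈ range T, ((t : ℝ) + 1) ≤ ∑ t ∈ range T, (T : ℝ) :=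
          sum_le_sum fun t ht => by exact_mod_cast mem_range.1 ht
      _ = _ := by simp [sq]
  have hsum := hsummand.sum_range (fun t => by positivity)
    (tendsto_atTop_mono hge tendsto_natCast_atTop_atTop)
  have hsum' : (fun T : ℕ => ∑ t ∈ range T, ((t : ℝ) + 1)) =O[atTop] fun T : ℕ => (T : ℝ) ^ 2 := by
    refine IsBigO.of_bound 1 (.of_forall fun T => ?_)
    rw [one_mul, Real.norm_of_nonneg ((Nat.cast_nonneg T).trans (hge T)),
      Real.norm_of_nonneg (by positivity)]
    exact hle T
  have hprod : (fun T => m T * z T) =o[atTop] fun T : ℕ => (T : ℝ) ^ 2 := by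
    simpa [sq] using hmO.mul_isLittleO hz
  have hconst : (fun _ : ℕ => m 0 * z 0) =o[atTop] fun T : ℕ => (T : ℝ) ^ 2 :=
    (const_isLittleO_natCast _).trans natCast_isLittleO_sq
  simp_rw [sum_range_mul_sub_eq]
  exact (hprod.sub hconst).sub (hsum.trans_isBigO hsum')

/-- A sequence with unit increments that is sublinear along the squares is sublinear. -/
theorem isLittleO_of_tendsto_sq {S : ℕ → ℝ} (hS : ∀ t, |S (t + 1) - S t| ≤ 1)
    (h : Tendsto (fun n : ℕ => S (n ^ 2) / (n : ℝ) ^ 2) atTop (𝓝 0)) :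
    S =o[atTop] fun T : ℕ => (T : ℝ) := by
  have hlip : ∀ s k, |S (s + k) - S s| ≤ k := by
    intro s k
    induction k with
    | zero => simp
    | succ k ih =>
      have h1 := abs_add_le (S (s + k + 1) - S (s + k)) (S (s + k) - S s)
      rw [sub_add_sub_cancel] at h1
      rw [← add_assoc]
      push_cast
      linarith [hS (s + k)]
  have hlim : Tendsto (fun n : ℕ => |S (n ^ 2) / (n : ℝ) ^ 2| + 2 * (n : ℝ)⁻¹) atTop (𝓝 0) := by
    simpa using h.abs.add ((tendsto_inv_atTop_nhds_zero_nat (𝕜 := ℝ)).const_mul 2)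
  have hsqrt : Tendsto Nat.sqrt atTop atTop :=
    tendsto_atTop_atTop.2 fun b => ⟨b ^ 2, fun a ha => Nat.le_sqrt'.2 ha⟩
  refine tendsto_div_natCast_iff_isLittleO.1
    (squeeze_zero_norm' ?_ (hlim.comp hsqrt))
  filter_upwards [eventually_gt_atTop 0] with T hT
  have hn : 0 < T.sqrt := Nat.sqrt_pos.2 hT
  have hnT : T.sqrt ^ 2 ≤ T := Nat.sqrt_le' T
  -- The gap from `T` down to the nearest square is `O(√T)`, so unit increments cannot spoil
  -- sublinearity in between.
  have hTn : T ≤ T.sqrt ^ 2 + 2 * T.sqrt := by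
    have := Nat.sqrt_le_add T
    nlinarith
  obtain ⟨k, hk⟩ := Nat.exists_eq_add_of_le hnT
  have hk2 : (k : ℝ) ≤ 2 * T.sqrt := by exact_mod_cast (by omega : k ≤ 2 * T.sqrt)
  have hl := hlip (T.sqrt ^ 2) k
  rw [← hk] at hl
  simp only [Function.comp, Real.norm_eq_abs, abs_div, Nat.abs_cast, abs_pow]
  generalize T.sqrt = n at *
  have hn' : (0 : ℝ) < n := by exact_mod_cast hn
  have hST : |S T| ≤ |S (n ^ 2)| + 2 * n := by
    have := abs_add_le (S T - S (n ^ 2)) (S (n ^ 2))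
    rw [sub_add_cancel] at this
    linarith
  have hsq : ((n : ℝ) ^ 2) ≤ T := by exact_mod_cast hnT
  calc |S T| / T ≤ (|S (n ^ 2)| + 2 * n) / (n : ℝ) ^ 2 := by gcongr
    _ = |S (n ^ 2)| / (n : ℝ) ^ 2 + 2 * (n : ℝ)⁻¹ := by field_simp

/-! ### Strong laws for orthogonal and predictable sums. -/

section

variable {Ω : Type*} [MeasurableSpace Ω] {P : Measure Ω}

/-- Orthogonality kills the cross terms, and each diagonal term contributes at most `1`. -/
theorem integral_sq_sum_le [IsProbabilityMeasure P] {X : ℕ → Ω → ℝ} (hX : ∀ t, Measurable (X t))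
    (hb : ∀ t ω, |X t ω| ≤ 1) (horth : ∀ s t, s < t → ∫ ω, X s ω * X t ω ∂P = 0) (T : ℕ) :
    ∫ ω, (∑ t ∈ range T, X t ω) ^ 2 ∂P ≤ T := by
  have hint : ∀ s t, Integrable (fun ω => X s ω * X t ω) P := fun s t => by
    refine Integrable.of_bound ((hX s).mul (hX t)).aestronglyMeasurable 1 (.of_forall fun ω => ?_)
    rw [norm_mul]
    exact mul_le_one₀ (hb s ω) (norm_nonneg _) (hb t ω)
  induction T with
  | zero => simp
  | succ T ih =>
    have hexp : ∀ ω, (∑ t ∈ range (T + 1), X t ω) ^ 2 =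
        (∑ t ∈ range T, X t ω) ^ 2 + 2 * ∑ t ∈ range T, X t ω * X T ω + X T ω * X T ω := fun ω => by
      rw [sum_range_succ, ← Finset.sum_mul]; ring
    have hsq : Integrable (fun ω => (∑ t ∈ range T, X t ω) ^ 2) P := by
      simp_rw [sq, sum_mul_sum]
      exact integrable_finsetSum _ fun s _ => integrable_finsetSum _ fun t _ => hint s t
    have hcross : Integrable (fun ω => 2 * ∑ t ∈ range T, X t ω * X T ω) P :=
      (integrable_finsetSum _ fun t _ => hint t T).const_mul 2
    have hadd : Integrable (fun ω => (∑ t ∈ range T, X t ω) ^ 2 +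
        2 * ∑ t ∈ range T, X t ω * X T ω) P := hsq.add hcross
    simp_rw [hexp]
    rw [integral_add hadd (hint T T), integral_add hsq hcross, integral_const_mul,
      integral_finsetSum _ fun t _ => hint t T,
      Finset.sum_eq_zero fun t ht => horth t T (mem_range.1 ht)]
    have hlast : ∫ ω, X T ω * X T ω ∂P ≤ 1 := by
      calc ∫ ω, X T ω * X T ω ∂P ≤ ∫ _, (1 : ℝ) ∂P :=
            integral_mono (hint T T) (integrable_const _) fun ω => by
              have := abs_le_one_iff_mul_self_le_one.1 (hb T ω)
              simpa using this
        _ = 1 := by simp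
    push_cast
    linarith

/-- Strong law of large numbers for bounded orthogonal random variables. -/
theorem ae_isLittleO_sum_of_orthogonal [IsProbabilityMeasure P] {X : ℕ → Ω → ℝ} (hX : ∀ t, Measurable (X t))
    (hb : ∀ t ω, |X t ω| ≤ 1) (horth : ∀ s t, s < t → ∫ ω, X s ω * X t ω ∂P = 0) :
    ∀ᵐ ω ∂P, (fun T => ∑ t ∈ range T, X t ω) =o[atTop] fun T : ℕ => (T : ℝ) := by
  -- Along the squares the second moments of the averages are at most `1 / n ^ 2`, hence summable,
  -- so the averages tend to zero almost surely.
  let f : ℕ → Ω → ℝ := fun n ω => ((∑ t ∈ range (n ^ 2), X t ω) / (n : ℝ) ^ 2) ^ 2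
  have hfm : ∀ n, Measurable (f n) := fun n => by
    have : Measurable fun ω => ∑ t ∈ range (n ^ 2), X t ω :=
      Finset.measurable_fun_sum _ fun t _ => hX t
    exact (this.div_const _).pow_const 2
  have hSb : ∀ T ω, |∑ t ∈ range T, X t ω| ≤ T := fun T ω =>
    (abs_sum_le_sum_abs _ _).trans ((sum_le_sum fun t _ => hb t ω).trans (by simp))
  have hlint : ∀ n : ℕ, ∫⁻ ω, ENNReal.ofReal (f n ω) ∂P ≤ ENNReal.ofReal (1 / (n : ℝ) ^ 2) := by
    intro n
    rw [← ofReal_integral_eq_lintegral_ofReal _ (.of_forall fun ω => sq_nonneg _)]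
    · refine ENNReal.ofReal_le_ofReal ?_
      have h1 := integral_sq_sum_le (P := P) hX hb horth (n ^ 2)
      have h2 : ∫ ω, f n ω ∂P =
          (∫ ω, (∑ t ∈ range (n ^ 2), X t ω) ^ 2 ∂P) / ((n : ℝ) ^ 2) ^ 2 := by
        rw [← integral_div]
        exact integral_congr_ae (.of_forall fun ω => div_pow _ _ _)
      refine h2.trans_le ?_
      push_cast at h1
      rcases n.eq_zero_or_pos with rfl | hn
      · simp
      · have : (0 : ℝ) < n := by exact_mod_cast hn
        rw [div_le_div_iff₀ (by positivity) (by positivity)]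
        nlinarith [pow_pos this 2]
    · refine Integrable.of_bound (hfm n).aestronglyMeasurable 1 (.of_forall fun ω => ?_)
      rw [Real.norm_of_nonneg (sq_nonneg _), sq_le_one_iff_abs_le_one, abs_div]
      refine div_le_one_of_le₀ ?_ (abs_nonneg _)
      have := hSb (n ^ 2) ω
      push_cast at this
      rwa [abs_of_nonneg (by positivity : (0 : ℝ) ≤ (n : ℝ) ^ 2)]
  have hfin : ∫⁻ ω, ∑' n, ENNReal.ofReal (f n ω) ∂P ≠ ⊤ := by
    rw [lintegral_tsum fun n => (hfm n).ennreal_ofReal.aemeasurable]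
    refine ne_top_of_le_ne_top ?_ (ENNReal.tsum_le_tsum hlint)
    exact (Real.summable_one_div_nat_pow.2 one_lt_two).tsum_ofReal_ne_top
  filter_upwards [ae_lt_top' (Measurable.tsum
    fun n => (hfm n).ennreal_ofReal).aemeasurable hfin] with ω hω
  refine isLittleO_of_tendsto_sq (fun t => ?_) ?_
  · rw [sum_range_succ, add_sub_cancel_left]; exact hb t ω
  · have h1 := ENNReal.tendsto_atTop_zero_of_tsum_ne_top hω.ne
    have h2 : Tendsto (fun n => f n ω) atTop (𝓝 0) := by
      have := (ENNReal.tendsto_toReal ENNReal.zero_ne_top).comp h1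
      simpa [Function.comp_def, ENNReal.toReal_ofReal, f, sq_nonneg] using this
    have h3 := (Real.continuous_sqrt.tendsto 0).comp h2
    rw [Real.sqrt_zero] at h3
    refine (tendsto_zero_iff_abs_tendsto_zero _).2 (h3.congr fun n => ?_)
    simp only [Function.comp, f]
    exact Real.sqrt_sq_eq_abs _

/-- Since `G` sees only coordinates in `S`, it may be evaluated with zeros elsewhere; it then
factors through a countable discrete space, where measurability is automatic. -/
theorem indepFun_of_dependsOn {κ : Type*} {Y : κ → Ω → ℕ} (hY : iIndepFun Y P)
    (hYm : ∀ k, Measurable (Y k)) {k : κ} {S : Finset κ} (hk : k ∉ S) {G : (κ → ℕ) → ℝ}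
    (hG : DependsOn G (S : Set κ)) :
    IndepFun (Y k) (fun ω => G fun i => Y i ω) P := by
  classical
  have h := hY.indepFun_finset {k} S (by simpa using hk) hYm
  have h2 := h.comp (φ := fun y : ({k} : Finset κ) → ℕ => y ⟨k, by simp⟩)
    (ψ := fun y : S → ℕ => G fun i => if hi : i ∈ S then y ⟨i, hi⟩ else 0)
    Measurable.of_discrete Measurable.of_discrete
  have h3 : (fun ω => G fun i => Y i ω) =
      fun ω => G fun i => if i ∈ S then Y i ω else 0 := by
    funext ω
    exact hG fun i hi => by simp [Finset.mem_coe.1 hi]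
  rw [h3]
  exact h2

theorem measurable_of_dependsOn {κ : Type*} {Y : κ → Ω → ℕ}
    (hYm : ∀ k, Measurable (Y k)) {S : Finset κ} {G : (κ → ℕ) → ℝ}
    (hG : DependsOn G (S : Set κ)) : Measurable fun ω => G fun i => Y i ω := by
  classical
  have h : Measurable fun y : S → ℕ => G fun i => if hi : i ∈ S then y ⟨i, hi⟩ else 0 :=
    Measurable.of_discrete
  convert h.comp (measurable_pi_lambda (fun ω (i : S) => Y i ω) fun i => hYm i) using 1
  funext ω
  exact hG fun i hi => by simp [Finset.mem_coe.1 hi]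

theorem IsBernoulli.nonneg {X : Ω → ℕ} {p : ℝ} (h : IsBernoulli P X p) : 0 ≤ p :=
  h.2.2 ▸ measureReal_nonneg

theorem IsBernoulli.le_one [IsProbabilityMeasure P] {X : Ω → ℕ} {p : ℝ} (h : IsBernoulli P X p) : p ≤ 1 :=
  h.2.2 ▸ measureReal_le_one

theorem IsBernoulli.abs_sub_le [IsProbabilityMeasure P] {X : Ω → ℕ} {p : ℝ} (h : IsBernoulli P X p) (ω : Ω) :
    |(X ω : ℝ) - p| ≤ 1 := by
  have h0 := h.nonneg
  have h1 := h.le_one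
  rcases h.2.1 ω with hω | hω <;> rw [hω, abs_le] <;> constructor <;> push_cast <;> linarith

theorem IsBernoulli.integral_eq {X : Ω → ℕ} {p : ℝ} (h : IsBernoulli P X p) :
    ∫ ω, (X ω : ℝ) ∂P = p := by
  have hset : MeasurableSet {ω | X ω = 1} := h.1 (measurableSet_singleton 1)
  have : (fun ω => (X ω : ℝ)) = {ω | X ω = 1}.indicator 1 := by
    funext ω
    rcases h.2.1 ω with hω | hω <;> simp [Set.indicator, hω]
  rw [this, integral_indicator_one hset, h.2.2]

theorem IsBernoulli.integral_sub_eq_zero [IsProbabilityMeasure P] {X : Ω → ℕ} {p : ℝ} (h : IsBernoulli P X p) :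
    ∫ ω, ((X ω : ℝ) - p) ∂P = 0 := by
  have hm : Measurable fun ω => (X ω : ℝ) := measurable_from_nat.comp h.1
  rw [integral_sub _ (integrable_const _), h.integral_eq]
  · simp
  · refine Integrable.of_bound hm.aestronglyMeasurable 1 (.of_forall fun ω => ?_)
    rcases h.2.1 ω with hω | hω <;> simp [hω]

/-- Strong law for centered Bernoulli variables with predictable weights. -/
theorem ae_isLittleO_sum_predictable_mul [IsProbabilityMeasure P] {κ : Type*} {Y : κ → Ω → ℕ} (hY : iIndepFun Y P)
    (hYm : ∀ k, Measurable (Y k)) {k : ℕ → κ} {S : ℕ → Finset κ} (hS : Monotone S)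
    (hk : ∀ t, k t ∉ S t) (hk' : ∀ t, k t ∈ S (t + 1)) {p : ℝ}
    (hB : ∀ t, IsBernoulli P (Y (k t)) p) {H : ℕ → (κ → ℕ) → ℝ}
    (hH : ∀ t, DependsOn (H t) (S t : Set κ)) (hHb : ∀ t y, |H t y| ≤ 1) :
    ∀ᵐ ω ∂P, (fun T => ∑ t ∈ range T, H t (fun i => Y i ω) * ((Y (k t) ω : ℝ) - p))
      =o[atTop] fun T : ℕ => (T : ℝ) := by
  have hcm : ∀ t, Measurable fun ω => (Y (k t) ω : ℝ) - p := fun t =>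
    (measurable_from_nat.comp (hYm _)).sub_const p
  refine ae_isLittleO_sum_of_orthogonal (fun t => ?_) (fun t ω => ?_) fun s t hst => ?_
  · exact (measurable_of_dependsOn hYm (hH t)).mul (hcm t)
  · rw [abs_mul]
    exact mul_le_one₀ (hHb _ _) (abs_nonneg _) ((hB t).abs_sub_le ω)
  -- All factors of the product except the last centered variable depend on coordinates in `S t`,
  -- which does not contain `k t`.
  · let G : (κ → ℕ) → ℝ := fun y => H s y * ((y (k s) : ℝ) - p) * H t y
    have hG : DependsOn G (S t : Set κ) := fun y y' hyy => by
      have hs := (hH s) fun i hi => hyy i (hS hst.le hi)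
      have ht := (hH t) hyy
      have hks := hyy (k s) (hS hst (hk' s))
      simp only [G, hs, ht, hks]
    have hind := (indepFun_of_dependsOn hY hYm (hk t) hG).comp
      (φ := fun n : ℕ => (n : ℝ) - p) (ψ := id) Measurable.of_discrete measurable_id
    have := hind.integral_fun_mul_eq_mul_integral (hcm t).aestronglyMeasurable
      (measurable_of_dependsOn hYm hG).aestronglyMeasurable
    simp only [Function.comp, id] at this
    rw [(hB t).integral_sub_eq_zero, zero_mul] at this
    rw [← this]
    exact integral_congr_ae (.of_forall fun ω => by simp only [G]; ring)

end

/-! ### The autonomous single channel and its workload. -/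

/-- A channel with arrivals `a` and coins `c` on which every attempt is made by some adaptive user:
the backlog of the uncooperative user, and whether the preceding slot had a collision. -/
def channel (a c : ℕ → ℕ) : ℕ → ℕ × Bool
  | 0 => (a 0, false)
  | t + 1 =>
    let s := channel a c t
    if s.2 = false ∧ c t = 1 then (s.1 + a (t + 1), decide (0 < s.1))
    else (s.1 - 1 + a (t + 1), false)

theorem channel_congr {a a' c c' : ℕ → ℕ} (t : ℕ) (ha : ∀ s ≤ t, a s = a' s)
    (hc : ∀ s < t, c s = c' s) : channel a c t = channel a' c' t := by
  induction t with
  | zero => simp [channel, ha]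
  | succ t ih =>
    have := ih (fun s hs => ha s (by omega)) fun s hs => hc s (by omega)
    simp only [channel, this, ha (t + 1) le_rfl, hc t (by omega)]

theorem channel_pos_of_collision (a c : ℕ → ℕ) (t : ℕ) (h : (channel a c t).2 = true) :
    0 < (channel a c t).1 := by
  cases t with
  | zero => simp [channel] at h
  | succ t =>
    simp only [channel] at h ⊢
    split_ifs at h ⊢ with h1
    · simp only [decide_eq_true_eq] at h
      omega

/-- Indicator of an empty backlog. -/
def emptyInd (s : ℕ × Bool) : ℝ := if s.1 = 0 then 1 else 0

/-- Indicator of a nonempty backlog in a slot that does not follow a collision. -/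
def freshInd (s : ℕ × Bool) : ℝ := if 0 < s.1 ∧ s.2 = false then 1 else 0

/-- The expected number of slots needed to clear the channel. -/
def workload (p : ℝ) (s : ℕ × Bool) : ℝ := (1 + p) * s.1 - if s.2 = true then p else 0

/-- Apart from arrivals, a nonempty fresh slot changes the workload by `-p` (collision) or `-(1 +
p)` (departure), that is, by `-1 + (c t - p)`. The slot after a collision changes it by `-(1 + p) +
p = -1`, and an empty slot by `0`. -/
theorem workload_succ_sub (p : ℝ) {a c : ℕ → ℕ} (hc : ∀ t, c t = 0 ∨ c t = 1) (t : ℕ) :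
    workload p (channel a c (t + 1)) - workload p (channel a c t) =
      (1 + p) * a (t + 1) - 1 + emptyInd (channel a c t) +
        freshInd (channel a c t) * ((c t : ℝ) - p) := by
  have hpos := channel_pos_of_collision a c t
  rw [channel]
  generalize channel a c t = s at *
  obtain ⟨q, b⟩ := s
  rcases q.eq_zero_or_pos with rfl | hq
  · have hb : b = false := by cases b <;> simp_all
    subst hb
    rcases hc t with h | h <;> simp [h, workload, emptyInd, freshInd]
  · obtain ⟨r, rfl⟩ := Nat.exists_eq_add_of_lt hq
    cases b <;> rcases hc t with h | h <;> simp [h, workload, emptyInd, freshInd] <;> ring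

section

variable {a c : ℕ → ℕ} {lam p : ℝ}

theorem workload_nonneg (hp0 : 0 ≤ p) (t : ℕ) : 0 ≤ workload p (channel a c t) := by
  have hpos := channel_pos_of_collision a c t
  generalize channel a c t = s at *
  unfold workload
  split_ifs with h
  · have : (1 : ℝ) ≤ s.1 := by exact_mod_cast hpos h
    nlinarith
  · rw [sub_zero]; positivity

theorem backlog_le_workload (hp0 : 0 ≤ p) (t : ℕ) :
    ((channel a c t).1 : ℝ) ≤ workload p (channel a c t) := by
  have hpos := channel_pos_of_collision a c t
  generalize channel a c t = s at *
  have h0 : (0 : ℝ) ≤ s.1 := by positivity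
  unfold workload
  split_ifs with h
  · have : (1 : ℝ) ≤ s.1 := by exact_mod_cast hpos h
    nlinarith
  · nlinarith

/-- If the channel is not overloaded, its workload is sublinear. -/
theorem workload_isLittleO (ha : ∀ t, a t = 0 ∨ a t = 1) (hc : ∀ t, c t = 0 ∨ c t = 1)
    (hp0 : 0 ≤ p) (hload : (1 + p) * lam ≤ 1)
    (hA : (fun T => ∑ t ∈ range T, ((a (t + 1) : ℝ) - lam)) =o[atTop] fun T : ℕ => (T : ℝ))
    (hF : (fun T => ∑ t ∈ range T, freshInd (channel a c t) * ((c t : ℝ) - p))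
      =o[atTop] fun T : ℕ => (T : ℝ)) :
    (fun T => workload p (channel a c T)) =o[atTop] fun T : ℕ => (T : ℝ) := by
  have ha1 : ∀ t, (a t : ℝ) ≤ 1 := fun t => by rcases ha t with h | h <;> simp [h]
  refine isLittleO_of_reflected (K := 1 + p)
    -- Away from zero the workload moves by the increment of this noise plus the drift `(1 + p) *
    -- lam - 1`, which is not positive.
    (z := fun T => (1 + p) * ∑ t ∈ range T, ((a (t + 1) : ℝ) - lam) +
      ∑ t ∈ range T, freshInd (channel a c t) * ((c t : ℝ) - p))
    (workload_nonneg hp0) ?_ (fun t h => ?_) (fun t h => ?_) ((hA.const_mul_left _).add hF)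
  · have := ha1 0
    simp only [workload, channel]
    simp only [Bool.false_eq_true, if_false]
    nlinarith
  · have hq : (channel a c t).1 = 0 := by
      have := backlog_le_workload (a := a) (c := c) hp0 t
      rw [h] at this
      exact_mod_cast le_antisymm this (Nat.cast_nonneg _)
    have := workload_succ_sub p (a := a) hc t
    simp only [h, emptyInd, freshInd, hq] at this
    have h1 := mul_le_mul_of_nonneg_left (ha1 (t + 1)) (by linarith : 0 ≤ 1 + p)
    simp only [if_true, lt_irrefl, false_and, if_false] at this
    linarith
  · have hq : (channel a c t).1 ≠ 0 := fun hq => by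
      have hb : (channel a c t).2 = false := by
        by_contra hb
        have := channel_pos_of_collision a c t (by simpa using hb)
        omega
      simp [workload, hq, hb] at h
    rw [workload_succ_sub p hc t, sum_range_succ, sum_range_succ]
    have hE : emptyInd (channel a c t) = 0 := by simp [emptyInd, hq]
    rw [hE]
    nlinarith

/-- The number of slots in which an attempt succeeds, up to a sublinear error. -/
theorem sum_success_isLittleO (hc : ∀ t, c t = 0 ∨ c t = 1)
    (hW : (fun T => workload p (channel a c T)) =o[atTop] fun T : ℕ => (T : ℝ))
    (hA : (fun T => ∑ t ∈ range T, ((a (t + 1) : ℝ) - lam)) =o[atTop] fun T : ℕ => (T : ℝ))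
    (hF : (fun T => ∑ t ∈ range T, freshInd (channel a c t) * ((c t : ℝ) - p))
      =o[atTop] fun T : ℕ => (T : ℝ))
    (hE : (fun T => ∑ t ∈ range T, emptyInd (channel a c t) * ((c t : ℝ) - p))
      =o[atTop] fun T : ℕ => (T : ℝ)) :
    (fun T => ∑ t ∈ range T, (emptyInd (channel a c t) * c t - p * (1 - (1 + p) * lam)))
      =o[atTop] fun T : ℕ => (T : ℝ) := by
  -- Replace the coin by its mean `p` at the cost of a martingale sum, and solve the telescoped
  -- workload balance for the number of empty slots.
  have hid : ∀ T, ∑ t ∈ range T, (emptyInd (channel a c t) * c t - p * (1 - (1 + p) * lam)) =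
      ∑ t ∈ range T, emptyInd (channel a c t) * ((c t : ℝ) - p) +
      p * (workload p (channel a c T) - workload p (channel a c 0) -
        (1 + p) * ∑ t ∈ range T, ((a (t + 1) : ℝ) - lam) -
        ∑ t ∈ range T, freshInd (channel a c t) * ((c t : ℝ) - p)) := fun T => by
    rw [← sum_range_sub (fun t => workload p (channel a c t)), mul_sum, ← sum_sub_distrib,
      ← sum_sub_distrib, mul_sum, ← sum_add_distrib]
    refine sum_congr rfl fun t _ => ?_
    rw [workload_succ_sub p hc t]
    ring
  simp_rw [hid]
  exact hE.add ((((hW.sub (const_isLittleO_natCast _)).sub (hA.const_mul_left _)).sub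
    hF).const_mul_left p)

end

theorem pStar_load {lam : ℝ} (h1 : lam ≤ 1) : (1 + pStar lam) * lam ≤ 1 := by
  unfold pStar
  split_ifs with h
  · linarith
  · have : lam ≠ 0 := by rintro rfl; norm_num at h
    have : (1 + (1 - lam) / (2 * lam)) * lam = (1 + lam) / 2 := by field_simp; ring
    linarith

/-- For `lam > 0` the concave quadratic `p * (1 - (1 + p) * lam)` peaks at `p = (1 - lam) / (2 *
lam)`, which reaches the cap `1` exactly when `lam ≤ 1 / 3`. -/
theorem pStar_throughput (lam : ℝ) : pStar lam * (1 - (1 + pStar lam) * lam) = muLb lam := by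
  unfold pStar muLb
  split_ifs with h
  · ring
  · have : lam ≠ 0 := by rintro rfl; norm_num at h
    field_simp
    ring

/-! ### Uncooperative queues in the network. -/

section

variable {Ω : Type*} {N M : ℕ} {J : Fin N → Finset (Fin M)} {sel : SelectRule Ω N M}
  {dat : DataRule Ω N M} {Aa : Fin N → ℕ → Ω → ℕ} {Au coin : Fin M → ℕ → Ω → ℕ}

/-- As some user is allowed on `j`, the rule `sel` never returns `none` there, so whether a
transmission takes place depends only on the feedback and the coin, not on the adaptive backlogs. -/
theorem path_eq_channel (hsel : IsLongestQueueFirst J sel) {j : Fin M} (hj : ∃ i, j ∈ J i)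
    (ω : Ω) (t : ℕ) :
    (path sel dat Aa Au coin ω t).qu j = (channel (Au j · ω) (coin j · ω) t).1 ∧
    ((path sel dat Aa Au coin ω t).fb j = .collision ↔
      (channel (Au j · ω) (coin j · ω) t).2 = true) := by
  induction t with
  | zero => simp [path, channel]
  | succ t ih =>
    obtain ⟨i₀, hi₀⟩ := hj
    obtain ⟨ih1, ih2⟩ := ih
    simp only [path, channel]
    generalize path sel dat Aa Au coin ω t = s at *
    generalize channel (Au j · ω) (coin j · ω) t = r at *
    have hne : sel t ω s.qa j ≠ none := fun h => (hsel t ω s.qa j).2 h i₀ hi₀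
    by_cases hatt : r.2 = false ∧ coin j t ω = 1
    · have hlb : lbAttempt (s.fb j) (coin j t ω) :=
        ⟨fun h => by simp [ih2.1 h] at hatt, hatt.2⟩
      rw [if_pos hatt]
      simp only [departU, transmitter, hlb, if_true, hne, and_false, if_false, feedback, ih1]
      refine ⟨rfl, ?_⟩
      by_cases hq : r.1 = 0 <;> simp [hq, Nat.pos_iff_ne_zero]
    · have hlb : ¬ lbAttempt (s.fb j) (coin j t ω) := fun h => hatt
        ⟨by rw [← Bool.not_eq_true]; exact fun h' => h.1 (ih2.2 h'), h.2⟩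
      rw [if_neg hatt]
      simp only [departU, transmitter, hlb, if_false, and_true, feedback, ih1]
      by_cases hq : r.1 = 0 <;> simp [hq, Nat.pos_iff_ne_zero]

/-- Without adaptive users there are no collisions, and every packet leaves in the slot of its
arrival. -/
theorem path_qu_le_one (hsel : IsLongestQueueFirst J sel) {j : Fin M} (hj : ¬ ∃ i, j ∈ J i)
    (hAu : ∀ t ω, Au j t ω ≤ 1) (ω : Ω) (t : ℕ) :
    (path sel dat Aa Au coin ω t).qu j ≤ 1 := by
  induction t with
  | zero => simpa [path] using hAu 0 ω
  | succ t ih =>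
    simp only [path]
    generalize path sel dat Aa Au coin ω t = s at *
    have htx : transmitter (sel t ω) (fun j => coin j t ω) s j = none := by
      unfold transmitter
      split_ifs
      · rcases h : sel t ω s.qa j with _ | i
        · rfl
        · exact absurd ⟨i, ((hsel t ω s.qa j).1 i h).1⟩ hj
      · rfl
    have := hAu (t + 1) ω
    simp only [departU, htx, and_true]
    split_ifs <;> omega

end

/-! ### Laws of large numbers for arrivals and coins. -/

section

variable {Ω : Type*} [MeasurableSpace Ω] {P : Measure Ω} {N M : ℕ}
  {lamA : Fin N → ℝ} {lamU : Fin M → ℝ} {Aa : Fin N → ℕ → Ω → ℕ} {Au coin : Fin M → ℕ → Ω → ℕ}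

theorem IsNetworkModel.measurable (h : IsNetworkModel P lamA lamU Aa Au coin)
    (k : (Fin N ⊕ Fin M ⊕ Fin M) × ℕ) :
    Measurable (Sum.elim Aa (Sum.elim Au coin) k.1 k.2) := by
  obtain ⟨i | j | j, t⟩ := k
  · exact h.measurable_Aa i t
  · exact (h.bernoulli_Au j t).1
  · exact (h.bernoulli_coin j t).1

theorem IsNetworkModel.ae_arrivalsU [IsProbabilityMeasure P]
    (h : IsNetworkModel P lamA lamU Aa Au coin) (j : Fin M) :
    ∀ᵐ ω ∂P, (fun T => ∑ t ∈ range T, ((Au j (t + 1) ω : ℝ) - lamU j))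
      =o[atTop] fun T : ℕ => (T : ℝ) := by
  classical
  have := ae_isLittleO_sum_predictable_mul h.indep h.measurable
    (k := fun t => (Sum.inr (Sum.inl j), t + 1))
    (S := fun t => (range (t + 1)).image fun s => (Sum.inr (Sum.inl j), s))
    (fun s t hst => image_subset_image (range_subset_range.2 (by omega)))
    (fun t => by simp) (fun t => by simp) (p := lamU j)
    (fun t => by simpa using h.bernoulli_Au j (t + 1)) (H := fun _ _ => 1)
    (fun t => fun _ _ _ => rfl) (fun t y => by simp)
  simpa using this

theorem IsNetworkModel.ae_coins [IsProbabilityMeasure P]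
    (h : IsNetworkModel P lamA lamU Aa Au coin) (j : Fin M)
    (f : ℕ × Bool → ℝ) (hf : ∀ s, |f s| ≤ 1) :
    ∀ᵐ ω ∂P, (fun T => ∑ t ∈ range T, f (channel (Au j · ω) (coin j · ω) t) *
      ((coin j t ω : ℝ) - pStar (lamU j))) =o[atTop] fun T : ℕ => (T : ℝ) := by
  classical
  have := ae_isLittleO_sum_predictable_mul h.indep h.measurable
    (k := fun t => (Sum.inr (Sum.inr j), t))
    -- The state in slot `t` includes the arrivals of slot `t` but only the coins of earlier slots,
    -- so the current coin is independent of it.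
    (S := fun t => (range (t + 1)).image (fun s => (Sum.inr (Sum.inl j), s)) ∪
      (range t).image (fun s => (Sum.inr (Sum.inr j), s)))
    (fun s t hst => union_subset_union (image_subset_image (range_subset_range.2 (by omega)))
      (image_subset_image (range_subset_range.2 hst)))
    (fun t => by simp) (fun t => by simp) (p := pStar (lamU j))
    (fun t => by simpa using h.bernoulli_coin j t)
    (H := fun t y => f (channel (fun s => y (Sum.inr (Sum.inl j), s))
      (fun s => y (Sum.inr (Sum.inr j), s)) t))
    (fun t y y' hyy => by
      refine congrArg f (channel_congr t (fun s hs => hyy _ ?_) fun s hs => hyy _ ?_)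
      · simpa using Nat.lt_succ_of_le hs
      · simpa using hs)
    (fun t y => hf _)
  simpa using this

theorem IsNetworkModel.ae_arrivalsA [IsProbabilityMeasure P]
    (h : IsNetworkModel P lamA lamU Aa Au coin) (i : Fin N) :
    ∀ᵐ ω ∂P, (fun T => ∑ t ∈ range T, ((Aa i (t + 1) ω : ℝ) - lamA i))
      =o[atTop] fun T : ℕ => (T : ℝ) := by
  obtain ⟨K, hK⟩ := h.bounded_Aa
  have hcast : Measurable fun n : ℕ => (n : ℝ) := measurable_from_nat
  have hid : ∀ t, IdentDistrib (fun ω => (Aa i t ω : ℝ)) (fun ω => (Aa i 0 ω : ℝ)) P P := fun t =>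
    (h.identDistrib_Aa i t).comp hcast
  have := strong_law_ae_real (μ := P) (fun t ω => (Aa i (t + 1) ω : ℝ))
    (Integrable.of_bound (hcast.comp (h.measurable_Aa i 1)).aestronglyMeasurable K
      (.of_forall fun ω => by simpa using hK i 1 ω))
    (fun s t hst => (h.indep.indepFun (i := (Sum.inl i, s + 1)) (j := (Sum.inl i, t + 1))
      (by simpa using hst)).comp hcast hcast)
    (fun t => (hid (t + 1)).trans (hid 1).symm)
  filter_upwards [this] with ω hω
  rw [(hid 1).integral_eq, h.mean_Aa i] at hω
  refine tendsto_div_natCast_iff_isLittleO.1 ?_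
  have h2 := hω.sub_const (lamA i)
  rw [sub_self] at h2
  refine h2.congr' ?_
  filter_upwards [eventually_gt_atTop 0] with T hT
  have : (T : ℝ) ≠ 0 := by positivity
  rw [sum_sub_distrib]
  simp only [sum_const, card_range, nsmul_eq_mul]
  field_simp

end

/-! ### Maximal backlogs and the service of Longest Queue First. -/

section

variable {N M : ℕ} (J : Fin N → Finset (Fin M))

/-- The largest backlog among the adaptive users allowed on channel `j`. -/
def maxBacklog (q : Fin N → ℕ) (j : Fin M) : ℕ := (univ.filter fun i => j ∈ J i).sup q

theorem abs_maxBacklog_sub_le {q q' : Fin N → ℕ} {L : ℕ} (h : ∀ i, q' i ≤ q i + L)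
    (h' : ∀ i, q i ≤ q' i + L) (j : Fin M) :
    |(maxBacklog J q' j : ℝ) - maxBacklog J q j| ≤ L := by
  have key : ∀ {q q' : Fin N → ℕ}, (∀ i, q' i ≤ q i + L) →
      maxBacklog J q' j ≤ maxBacklog J q j + L := fun {q q'} h =>
    Finset.sup_le fun i hi => (h i).trans (Nat.add_le_add_right (le_sup (f := q) hi) L)
  have h1 : (maxBacklog J q' j : ℝ) ≤ maxBacklog J q j + L := by exact_mod_cast key h
  have h2 : (maxBacklog J q j : ℝ) ≤ maxBacklog J q' j + L := by exact_mod_cast key h'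
  rw [abs_le]
  constructor <;> linarith

theorem maxBacklog_eq_zero (q : Fin N → ℕ) {j : Fin M} (hj : ¬ ∃ i, j ∈ J i) :
    maxBacklog J q j = 0 := by
  have : (univ.filter fun i => j ∈ J i) = ∅ :=
    filter_eq_empty_iff.2 fun i _ hi => hj ⟨i, hi⟩
  simp [maxBacklog, this]

/-- A feasible rate splitting gives every backlog vector at most the weight that the channels can
serve. -/
theorem sum_backlog_mul_le {lamA : Fin N → ℝ} {mu : Fin M → ℝ} {ρ : Fin N → Fin M → ℝ}
    (hρ0 : ∀ i, ∀ j ∈ J i, 0 ≤ ρ i j) (hρA : ∀ i, lamA i ≤ ∑ j ∈ J i, ρ i j)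
    (hρU : ∀ j, ∑ i with j ∈ J i, ρ i j ≤ mu j) (q : Fin N → ℕ) :
    ∑ i, (q i : ℝ) * lamA i ≤ ∑ j, (maxBacklog J q j : ℝ) * mu j := by
  calc ∑ i, (q i : ℝ) * lamA i ≤ ∑ i, (q i : ℝ) * ∑ j ∈ J i, ρ i j := by
        gcongr with i; exact hρA i
    _ = ∑ j, ∑ i with j ∈ J i, (q i : ℝ) * ρ i j := by
        simp_rw [mul_sum]
        exact sum_comm' (by simp)
    _ ≤ ∑ j, ∑ i with j ∈ J i, (maxBacklog J q j : ℝ) * ρ i j := by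
        refine sum_le_sum fun j _ => sum_le_sum fun i hi => ?_
        have : q i ≤ maxBacklog J q j := le_sup (f := q) hi
        have h0 := hρ0 i j (mem_filter.1 hi).2
        gcongr
    _ ≤ ∑ j, (maxBacklog J q j : ℝ) * mu j := by
        simp_rw [← mul_sum]
        gcongr with j; exact hρU j

variable {J} {sel : (Fin N → ℕ) → Fin M → Option (Fin N)}
  {dat : Fin N → ℕ → Finset (Fin M) → Finset (Fin M)} {coin : Fin M → ℕ} {s : State N M}

theorem departA_le_backlog (hdat : ∀ i q S, dat i q S ⊆ S ∧ (dat i q S).card = min S.card q)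
    (tx : Fin M → Option (Fin N)) (i : Fin N) : departA dat tx s i ≤ s.qa i :=
  (card_filter_le _ _).trans ((hdat i _ _).2.le.trans (min_le_right _ _))

theorem departA_le_channels (tx : Fin M → Option (Fin N)) (i : Fin N) :
    departA dat tx s i ≤ M :=
  (card_le_univ _).trans (by simp)

/-- Longest Queue First serves the largest backlog on every channel with a successful attempt, up
to a bounded loss by dummy packets. -/
theorem sum_success_mul_maxBacklog_le
    (hsel : ∀ q j, (∀ i, sel q j = some i → j ∈ J i ∧ ∀ i', j ∈ J i' → q i' ≤ q i) ∧
      (sel q j = none → ∀ i, j ∉ J i))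
    (hdat : ∀ i q S, dat i q S ⊆ S ∧ (dat i q S).card = min S.card q) :
    ∑ j, (if s.qu j = 0 ∧ lbAttempt (s.fb j) (coin j) then maxBacklog J s.qa j else 0) ≤
      ∑ i, s.qa i * departA dat (transmitter sel coin s) s i + N * M ^ 2 := by
  set tx := transmitter sel coin s with htx
  have hserved : ∀ i, ∑ j, (if tx j = some i ∧ s.qu j = 0 then s.qa i else 0) ≤
      s.qa i * departA dat tx s i + M ^ 2 := by
    intro i
    have hcard : ∑ j, (if tx j = some i ∧ s.qu j = 0 then s.qa i else 0) =
        s.qa i * ((assigned tx i).filter fun j => s.qu j = 0).card := by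
      rw [← sum_filter, sum_const, smul_eq_mul, mul_comm, assigned, filter_filter]
    have hM : ∀ S : Finset (Fin M), S.card ≤ M := fun S => (card_le_univ S).trans (by simp)
    rw [hcard]
    -- With at least `M` queued packets no dummy is sent. Otherwise the whole weight, backlog times
    -- number of successes, is at most `M * M`.
    rcases le_total M (s.qa i) with h | h
    · have hfull : dat i (s.qa i) (assigned tx i) = assigned tx i := by
        refine eq_of_subset_of_card_le (hdat i _ _).1 ?_
        rw [(hdat i _ _).2, min_eq_left ((hM _).trans h)]
      rw [departA, hfull]
      omega
    · have := Nat.mul_le_mul h (hM ((assigned tx i).filter fun j => s.qu j = 0))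
      rw [sq]
      omega
  calc _ ≤ ∑ j, ∑ i, (if tx j = some i ∧ s.qu j = 0 then s.qa i else 0) := by
        refine sum_le_sum fun j _ => ?_
        split_ifs with h
        · have hj : tx j = sel s.qa j := by rw [htx, transmitter, if_pos h.2]
          rcases hi : sel s.qa j with _ | i
          · rw [maxBacklog_eq_zero J _ fun ⟨i, h'⟩ => (hsel s.qa j).2 hi i h']
            exact Nat.zero_le _
          · have hmax : maxBacklog J s.qa j ≤ s.qa i :=
              Finset.sup_le fun i' hi' => ((hsel s.qa j).1 i hi).2 i' (mem_filter.1 hi').2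
            exact hmax.trans (by simp [hj, hi, h.1])
        · exact Nat.zero_le _
    _ = ∑ i, ∑ j, (if tx j = some i ∧ s.qu j = 0 then s.qa i else 0) := sum_comm
    _ ≤ ∑ i, (s.qa i * departA dat tx s i + M ^ 2) := sum_le_sum fun i _ => hserved i
    _ = _ := by simp [sum_add_distrib]

end

/-! ### Quadratic drift and rate stability of the adaptive users. -/

section

variable {Ω : Type*} {N M : ℕ} {J : Fin N → Finset (Fin M)} {sel : SelectRule Ω N M}
  {dat : DataRule Ω N M} {Aa : Fin N → ℕ → Ω → ℕ} {Au coin : Fin M → ℕ → Ω → ℕ}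

/-- Success indicator of an attempt on channel `j` in slot `t`. -/
def successInd (Au coin : Fin M → ℕ → Ω → ℕ) (ω : Ω) (j : Fin M) (t : ℕ) : ℝ :=
  emptyInd (channel (Au j · ω) (coin j · ω) t) * coin j t ω

/-- An empty uncooperative queue excludes a preceding collision, so the coin alone decides about the
attempt. On a channel with no allowed user, `channel` need not describe the network, but there the
weight `maxBacklog` is zero. -/
theorem successInd_mul_maxBacklog (hsel : IsLongestQueueFirst J sel)
    {ω : Ω} (hc : ∀ j t, coin j t ω = 0 ∨ coin j t ω = 1) (t : ℕ) (j : Fin M) :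
    let s := path sel dat Aa Au coin ω t
    ((if s.qu j = 0 ∧ lbAttempt (s.fb j) (coin j t ω) then maxBacklog J s.qa j else 0 : ℕ) : ℝ) =
      maxBacklog J s.qa j * successInd Au coin ω j t := by
  intro s
  by_cases hj : ∃ i, j ∈ J i
  · obtain ⟨h1, h2⟩ := path_eq_channel (dat := dat) (Aa := Aa) (Au := Au) (coin := coin) hsel hj ω t
    have hpos := channel_pos_of_collision (Au j · ω) (coin j · ω) t
    change s.qu j = _ at h1
    change s.fb j = _ ↔ _ at h2
    unfold successInd emptyInd lbAttempt
    rw [h1]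
    rcases Nat.eq_zero_or_pos (channel (Au j · ω) (coin j · ω) t).1 with hq | hq
    · have hfb : s.fb j ≠ .collision := fun h => by have := hpos (h2.1 h); omega
      rcases hc j t with h | h <;> simp [hq, h, hfb]
    · simp [hq.ne']
  · simp [maxBacklog_eq_zero J _ hj]

theorem path_qa_succ (ω : Ω) (t : ℕ) (i : Fin N) :
    (path sel dat Aa Au coin ω (t + 1)).qa i =
      (path sel dat Aa Au coin ω t).qa i - departA (dat t ω)
        (transmitter (sel t ω) (fun j => coin j t ω) (path sel dat Aa Au coin ω t))
        (path sel dat Aa Au coin ω t) i + Aa i (t + 1) ω := rfl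

theorem path_qa_le_add {K : ℕ} (hK : ∀ i t ω, Aa i t ω ≤ K) (ω : Ω) (t : ℕ) (i : Fin N) :
    (path sel dat Aa Au coin ω (t + 1)).qa i ≤ (path sel dat Aa Au coin ω t).qa i + (K + M) ∧
    (path sel dat Aa Au coin ω t).qa i ≤ (path sel dat Aa Au coin ω (t + 1)).qa i + (K + M) := by
  rw [path_qa_succ]
  have h1 := departA_le_channels (dat := dat t ω) (s := path sel dat Aa Au coin ω t)
    (transmitter (sel t ω) (fun j => coin j t ω) (path sel dat Aa Au coin ω t)) i
  have h2 := hK i (t + 1) ω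
  omega

/-- Drift of the sum of the squared backlogs of the adaptive users. -/
theorem sum_sq_backlog_succ_le (hsel : IsLongestQueueFirst J sel) (hdat : IsDataRule dat)
    {lamA : Fin N → ℝ} {mu : Fin M → ℝ} {ρ : Fin N → Fin M → ℝ}
    (hρ0 : ∀ i, ∀ j ∈ J i, 0 ≤ ρ i j) (hρA : ∀ i, lamA i ≤ ∑ j ∈ J i, ρ i j)
    (hρU : ∀ j, ∑ i with j ∈ J i, ρ i j ≤ mu j) {K : ℕ} (hK : ∀ i t ω, Aa i t ω ≤ K)
    {ω : Ω} (hc : ∀ j t, coin j t ω = 0 ∨ coin j t ω = 1) (t : ℕ) :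
    let q := fun t i => ((path sel dat Aa Au coin ω t).qa i : ℝ)
    let m := fun t j => (maxBacklog J (path sel dat Aa Au coin ω t).qa j : ℝ)
    ∑ i, q (t + 1) i ^ 2 ≤ ∑ i, q t i ^ 2 + (N * (K + M) ^ 2 + 2 * (N * M ^ 2)) +
      2 * ∑ i, q t i * ((Aa i (t + 1) ω : ℝ) - lamA i) -
      2 * ∑ j, m t j * (successInd Au coin ω j t - mu j) := by
  intro q m
  set s := path sel dat Aa Au coin ω t with hs
  set d : Fin N → ℕ := departA (dat t ω) (transmitter (sel t ω) (fun j => coin j t ω) s) s with hd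
  have hsucc : ∀ i, q (t + 1) i = q t i - d i + Aa i (t + 1) ω := fun i => by
    have := departA_le_backlog (s := s) (hdat t ω)
      (transmitter (sel t ω) (fun j => coin j t ω) s) i
    simp only [q, path_qa_succ]
    rw [Nat.cast_add, ← hs, ← hd, Nat.cast_sub this]
  have hsq : ∀ i, q (t + 1) i ^ 2 ≤ q t i ^ 2 + 2 * (q t i * Aa i (t + 1) ω) -
      2 * (q t i * d i) + ((K : ℝ) + M) ^ 2 := fun i => by
    have h1 : (d i : ℝ) ≤ M := by exact_mod_cast departA_le_channels _ i
    have h2 : (Aa i (t + 1) ω : ℝ) ≤ K := by exact_mod_cast hK i (t + 1) ω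
    have h3 : (0 : ℝ) ≤ d i := by positivity
    have h4 : (0 : ℝ) ≤ Aa i (t + 1) ω := by positivity
    have h5 : ((Aa i (t + 1) ω : ℝ) - d i) ^ 2 ≤ ((K : ℝ) + M) ^ 2 := by
      apply sq_le_sq' <;> linarith
    rw [hsucc]
    linarith
  have hserve : ∑ j, m t j * successInd Au coin ω j t ≤ ∑ i, q t i * d i + N * M ^ 2 := by
    have h := sum_success_mul_maxBacklog_le (s := s) (coin := fun j => coin j t ω)
      (hsel t ω) (hdat t ω)
    have h' := (Nat.cast_le (α := ℝ)).2 h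
    rw [Nat.cast_sum, sum_congr rfl fun j _ =>
      successInd_mul_maxBacklog (dat := dat) (Aa := Aa) (Au := Au) hsel hc t j] at h'
    push_cast at h'
    exact h'
  have hfeas := sum_backlog_mul_le J hρ0 hρA hρU s.qa
  have htot := sum_le_sum fun i (_ : i ∈ univ) => hsq i
  simp only [sum_add_distrib, sum_sub_distrib, ← mul_sum, sum_const, card_univ, Fintype.card_fin,
    nsmul_eq_mul] at htot
  simp only [mul_sub, sum_sub_distrib]
  change ∑ i, q t i * lamA i ≤ ∑ j, m t j * mu j at hfeas
  linarith

/-- If arrivals and successful attempts obey the law of large numbers with feasible rates, the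
adaptive users are rate stable. -/
theorem path_qa_isLittleO (hsel : IsLongestQueueFirst J sel) (hdat : IsDataRule dat)
    {lamA : Fin N → ℝ} {mu : Fin M → ℝ} {ρ : Fin N → Fin M → ℝ}
    (hρ0 : ∀ i, ∀ j ∈ J i, 0 ≤ ρ i j) (hρA : ∀ i, lamA i ≤ ∑ j ∈ J i, ρ i j)
    (hρU : ∀ j, ∑ i with j ∈ J i, ρ i j ≤ mu j) {K : ℕ} (hK : ∀ i t ω, Aa i t ω ≤ K)
    {ω : Ω} (hc : ∀ j t, coin j t ω = 0 ∨ coin j t ω = 1)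
    (hA : ∀ i, (fun T => ∑ t ∈ range T, ((Aa i (t + 1) ω : ℝ) - lamA i))
      =o[atTop] fun T : ℕ => (T : ℝ))
    (hG : ∀ j, (fun T => ∑ t ∈ range T, (successInd Au coin ω j t - mu j))
      =o[atTop] fun T : ℕ => (T : ℝ)) (i : Fin N) :
    (fun T => ((path sel dat Aa Au coin ω T).qa i : ℝ)) =o[atTop] fun T : ℕ => (T : ℝ) := by
  set q : ℕ → Fin N → ℝ := fun t i => ((path sel dat Aa Au coin ω t).qa i : ℝ) with hq
  set m : ℕ → Fin M → ℝ := fun t j => (maxBacklog J (path sel dat Aa Au coin ω t).qa j : ℝ)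
    with hm
  set C : ℝ := N * (K + M) ^ 2 + 2 * (N * M ^ 2)
  have hstep := path_qa_le_add (sel := sel) (dat := dat) (Au := Au) (coin := coin) hK ω
  have hqlip : ∀ i t, |q (t + 1) i - q t i| ≤ (K + M : ℕ) := fun i t => by
    obtain ⟨h1, h2⟩ := hstep t i
    have h1' := (Nat.cast_le (α := ℝ)).2 h1
    have h2' := (Nat.cast_le (α := ℝ)).2 h2
    rw [Nat.cast_add] at h1' h2'
    rw [abs_le]
    simp only [q]
    constructor <;> linarith
  have hmlip : ∀ j t, |m (t + 1) j - m t j| ≤ (K + M : ℕ) := fun j t =>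
    abs_maxBacklog_sub_le J (fun i => (hstep t i).1) (fun i => (hstep t i).2) j
  have hnoiseA : ∀ i, (fun T => ∑ t ∈ range T, q t i * ((Aa i (t + 1) ω : ℝ) - lamA i))
      =o[atTop] fun T : ℕ => (T : ℝ) ^ 2 := fun i => by
    simpa only [sum_range_succ, add_sub_cancel_left] using sum_range_mul_sub_isLittleO (m := (q · i)) (hqlip i) (hA i)
  have hnoiseG : ∀ j, (fun T => ∑ t ∈ range T, m t j * (successInd Au coin ω j t - mu j))
      =o[atTop] fun T : ℕ => (T : ℝ) ^ 2 := fun j => by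
    simpa only [sum_range_succ, add_sub_cancel_left] using sum_range_mul_sub_isLittleO (m := (m · j)) (hmlip j) (hG j)
  have hbound : ∀ T : ℕ, ∑ i, q T i ^ 2 ≤ ∑ i, q 0 i ^ 2 + C * T +
      2 * ∑ i, ∑ t ∈ range T, q t i * ((Aa i (t + 1) ω : ℝ) - lamA i) -
      2 * ∑ j, ∑ t ∈ range T, m t j * (successInd Au coin ω j t - mu j) := by
    intro T
    induction T with
    | zero => simp
    | succ T ih =>
      have := sum_sq_backlog_succ_le (Au := Au) hsel hdat hρ0 hρA hρU hK hc T
      simp only [sum_range_succ, sum_add_distrib]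
      push_cast
      simp only at this
      linarith
  have hrhs : (fun T : ℕ => ∑ i, q 0 i ^ 2 + C * T +
      2 * ∑ i, ∑ t ∈ range T, q t i * ((Aa i (t + 1) ω : ℝ) - lamA i) -
      2 * ∑ j, ∑ t ∈ range T, m t j * (successInd Au coin ω j t - mu j))
      =o[atTop] fun T : ℕ => (T : ℝ) ^ 2 :=
    (((((const_isLittleO_natCast _).trans natCast_isLittleO_sq).add
      (natCast_isLittleO_sq.const_mul_left C)).add
      ((IsLittleO.fun_sum fun i _ => hnoiseA i).const_mul_left 2)).sub
      ((IsLittleO.fun_sum fun j _ => hnoiseG j).const_mul_left 2))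
  have hsq : (fun T => q T i ^ 2) =o[atTop] fun T : ℕ => (T : ℝ) ^ 2 := by
    refine IsBigO.trans_isLittleO (IsBigO.of_bound 1 (.of_forall fun T => ?_)) hrhs
    rw [one_mul, Real.norm_of_nonneg (sq_nonneg _)]
    exact (single_le_sum (f := fun i => q T i ^ 2) (fun _ _ => sq_nonneg _) (mem_univ i)).trans
      ((hbound T).trans (le_abs_self _))
  -- A square that is `o(T ^ 2)` has a root that is `o(T)`.
  exact IsLittleO.of_pow hsq two_ne_zero

end

end LQF

theorem theorem2 {Ω : Type*} [MeasurableSpace Ω] (P : Measure Ω) [IsProbabilityMeasure P]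
    (N M : ℕ) (J : Fin N → Finset (Fin M)) (lamA : Fin N → ℝ) (lamU : Fin M → ℝ)
    (Aa : Fin N → ℕ → Ω → ℕ) (Au coin : Fin M → ℕ → Ω → ℕ)
    (hmodel : LQF.IsNetworkModel P lamA lamU Aa Au coin)
    (hrates : ∃ ρ : Fin N → Fin M → ℝ,
      (∀ i, ∀ j ∈ J i, 0 ≤ ρ i j ∧ ρ i j ≤ 1) ∧
      (∀ i, lamA i ≤ ∑ j ∈ J i, ρ i j) ∧
      (∀ j, ∑ i with j ∈ J i, ρ i j ≤ LQF.muLb (lamU j)))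
    (sel : LQF.SelectRule Ω N M) (hsel : LQF.IsLongestQueueFirst J sel)
    (dat : LQF.DataRule Ω N M) (hdat : LQF.IsDataRule dat) :
    (∀ i, LQF.RateStable P (fun t ω => (LQF.path sel dat Aa Au coin ω t).qa i)) ∧
    (∀ j, LQF.RateStable P (fun t ω => (LQF.path sel dat Aa Au coin ω t).qu j)) := by
  obtain ⟨ρ, hρ, hρA, hρU⟩ := hrates
  obtain ⟨K, hK⟩ := hmodel.bounded_Aa
  have ha : ∀ j t ω, Au j t ω = 0 ∨ Au j t ω = 1 := fun j t => (hmodel.bernoulli_Au j t).2.1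
  have hc : ∀ j t ω, coin j t ω = 0 ∨ coin j t ω = 1 := fun j t => (hmodel.bernoulli_coin j t).2.1
  have hU := ae_all_iff.2 hmodel.ae_arrivalsU
  have hF := ae_all_iff.2 fun j => hmodel.ae_coins j LQF.freshInd fun s => by
    unfold LQF.freshInd; split_ifs <;> simp
  have hE := ae_all_iff.2 fun j => hmodel.ae_coins j LQF.emptyInd fun s => by
    unfold LQF.emptyInd; split_ifs <;> simp
  have hp0 : ∀ j, 0 ≤ LQF.pStar (lamU j) := fun j => (hmodel.bernoulli_coin j 0).nonneg
  have hload : ∀ j, (1 + LQF.pStar (lamU j)) * lamU j ≤ 1 := fun j =>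
    LQF.pStar_load (hmodel.bernoulli_Au j 0).le_one
  constructor
  · intro i
    filter_upwards [ae_all_iff.2 hmodel.ae_arrivalsA, hU, hF, hE] with ω hA hU hF hE
    refine LQF.tendsto_div_natCast_iff_isLittleO.2 (LQF.path_qa_isLittleO hsel hdat
      (fun i j hj => (hρ i j hj).1) hρA hρU hK (fun j t => hc j t ω) hA (fun j => ?_) i)
    -- The success rate is proved for the autonomous channel process of every `j`, including
    -- channels that no adaptive user may use.
    have hW := LQF.workload_isLittleO (fun t => ha j t ω) (fun t => hc j t ω) (hp0 j) (hload j)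
      (hU j) (hF j)
    have := LQF.sum_success_isLittleO (fun t => hc j t ω) hW (hU j) (hF j) (hE j)
    rw [LQF.pStar_throughput] at this
    exact this
  · intro j
    filter_upwards [hU, hF] with ω hU hF
    refine LQF.tendsto_div_natCast_iff_isLittleO.2 ?_
    by_cases hj : ∃ i, j ∈ J i
    · have hW := LQF.workload_isLittleO (fun t => ha j t ω) (fun t => hc j t ω) (hp0 j) (hload j)
        (hU j) (hF j)
      refine Asymptotics.IsBigO.trans_isLittleO (.of_bound 1 (.of_forall fun T => ?_)) hW
      rw [(LQF.path_eq_channel hsel hj ω T).1, one_mul, Real.norm_natCast]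
      exact (LQF.backlog_le_workload (hp0 j) T).trans (le_abs_self _)
    · refine Asymptotics.IsBigO.trans_isLittleO (.of_bound 1 (.of_forall fun T => ?_))
        (LQF.const_isLittleO_natCast 1)
      have := LQF.path_qu_le_one (dat := dat) (Aa := Aa) (coin := coin) (Au := Au) hsel hj
        (fun t ω => by rcases ha j t ω with h | h <;> omega) ω T
      simpa using this
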